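/- Let $k$ be an algebraically closed field of characteristic zero and let $\mathcal G$ be an abelian $k$-linear tensor category: an abelian $k$-linear category with a $k$-bilinear symmetric monoidal structure, rigid (every object $X$ has a dual $X^*$ with coevaluation $\kappa_X:1\to X\otimes X^*$ and evaluation $ev_X:X^*\otimes X\to 1$), with $\mathrm{End}_{\mathcal G}(1)=k$. For $f\in\mathrm{End}(X)$ let $Tr_X(f)\in k$ be the scalar by which the composition $$1\xrightarrow{\kappa_X}X\otimes X^*\xrightarrow{f\otimes I}X\otimes X^*\xrightarrow{c_{X,X^*}}X^*\otimes X\xrightarrow{ev_X}1$$ acts, where $c$ is the commutativity constraint. Let $K_0(\mathcal G)$ be the Grothendieck ring of $\mathcal G$, generated by the classes $[X]$ of objects with $[X_2]=[X_1]+[X_3]$ for every short exact sequence $0\to X_1\to X_2\to X_3\to 0$ and product $[X][Y]=[X\otimes Y]$. For an endomorphism $g$ of the identity functor let $x\mapsto Tr(g_x)$ be the additive map $K_0(\mathcal G)\to k$ with $[X]\mapsto Tr_X(g_X)$. For an object $X$ let $\Lambda^n(X)\subset X^{\otimes n}$ be the $n$-th exterior power (the part of $X^{\otimes n}$ on which $S_n$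 acts by the sign character), and put $\lambda_t([X])=\sum_{n\ge 0}[\Lambda^n(X)]t^n\in K_0(\mathcal G)[[t]]$, extended to virtual objects (formal integral combinations of objects) by $\lambda_t(x+y)=\lambda_t(x)\lambda_t(y)$. The Adams operations $\psi^n$, $n\ge 1$, are defined by $\psi_t(x)=\sum_{n\ge 1}\psi^n(x)t^n$ and $\psi_{-t}(x)=-t\,\lambda_t'(x)/\lambda_t(x)$. Then for every monoidal automorphism $g$ of the identity functor of $\mathcal G$ (that is, $g_{X\otimes Y}=g_X\otimes g_Y$ for all $X,Y$), every $n\ge 1$, every $x\in K_0(\mathcal G)$ and every virtual object $v$ with class $x$, $$Tr(g_{\psi^n(v)})=Tr(g^n_x).$$ In particular $Tr(g_{\psi^n([X])})=Tr_X(g_X^n)$ for every object $X$. -/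

import Mathlib

open CategoryTheory CategoryTheory.Limits CategoryTheory.MonoidalCategory

set_option linter.unusedSectionVars false

noncomputable section

namespace TensorCat

universe w v u

section Monoidal

variable {C : Type u} [Category.{v} C] [MonoidalCategory C] [SymmetricCategory C]
  [RightRigidCategory C]

/-- The closed-up endomorphism `1 → X ⊗ X* → X ⊗ X* → X* ⊗ X → 1` of the unit object attached to
an endomorphism `f` of `X`. -/
def loop {X : C} (f : X ⟶ X) : 𝟙_ C ⟶ 𝟙_ C :=
  η_ X (Xᘁ) ≫ f ▷ Xᘁ ≫ (β_ X (Xᘁ)).hom ≫ ε_ X (Xᘁ)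

theorem loop_comm {X Y : C} (f : X ⟶ Y) (h : Y ⟶ X) : loop (f ≫ h) = loop (h ≫ f) := by
  unfold loop
  rw [comp_whiskerRight, comp_whiskerRight, Category.assoc, ← coevaluation_comp_rightAdjointMate_assoc,
    Category.assoc, whisker_exchange_assoc]
  congr 2
  rw [BraidedCategory.braiding_naturality_right_assoc, rightAdjointMate_comp_evaluation,
    BraidedCategory.braiding_naturality_left_assoc]

end Monoidal

section Abelian

variable {C : Type u} [Category.{v} C] [Abelian C] [MonoidalCategory C] [SymmetricCategory C]
  [RightRigidCategory C] [MonoidalPreadditive C]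

theorem shortExact_tensorLeft (X : C) {S : ShortComplex C} (hS : S.ShortExact) :
    (S.map (tensorLeft X)).ShortExact := by
  let _ : ExactPairing (Xᘁ) X := BraidedCategory.exactPairing_swap X (Xᘁ)
  have : (tensorLeft X).IsLeftAdjoint := (tensorLeftAdjunction (Xᘁ) X).isLeftAdjoint
  have : (tensorLeft X).IsRightAdjoint := (tensorLeftAdjunction X (Xᘁ)).isRightAdjoint
  exact hS.map_of_exact (tensorLeft X)

theorem shortExact_tensorRight (X : C) {S : ShortComplex C} (hS : S.ShortExact) :
    (S.map (tensorRight X)).ShortExact := by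
  let _ : ExactPairing (Xᘁ) X := BraidedCategory.exactPairing_swap X (Xᘁ)
  have : (tensorRight X).IsLeftAdjoint := (tensorRightAdjunction X (Xᘁ)).isLeftAdjoint
  have : (tensorRight X).IsRightAdjoint := (tensorRightAdjunction (Xᘁ) X).isRightAdjoint
  exact hS.map_of_exact (tensorRight X)

theorem mate_zero {X Y : C} : ((0 : X ⟶ Y)ᘁ) = 0 := by
  simp [rightAdjointMate]

/-- Morphisms into the dual of `B` that vanish on the subobject `A` factor through the dual of
the quotient. -/
theorem exists_lift_mate {S : ShortComplex C} (hS : S.ShortExact) {T : C} (x : T ⟶ S.X₂ᘁ)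
    (hx : x ≫ (S.fᘁ) = 0) : ∃ y : T ⟶ S.X₃ᘁ, y ≫ (S.gᘁ) = x := by
  have hT := shortExact_tensorLeft T hS
  have := hT.epi_g
  have h0 : T ◁ S.f ≫ x ▷ S.X₂ ≫ ε_ S.X₂ (S.X₂ᘁ) = 0 := by
    rw [whisker_exchange_assoc, ← rightAdjointMate_comp_evaluation, ← comp_whiskerRight_assoc, hx]
    simp
  obtain ⟨φ, hφ⟩ : ∃ φ : T ⊗ S.X₃ ⟶ 𝟙_ C, T ◁ S.g ≫ φ = x ▷ S.X₂ ≫ ε_ S.X₂ (S.X₂ᘁ) :=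
    ⟨hT.exact.desc _ h0, hT.exact.g_desc _ h0⟩
  refine ⟨tensorRightHomEquiv T S.X₃ (S.X₃ᘁ) (𝟙_ C) φ ≫ (λ_ _).hom, ?_⟩
  set y := tensorRightHomEquiv T S.X₃ (S.X₃ᘁ) (𝟙_ C) φ ≫ (λ_ _).hom with hy
  have key : ∀ {B : C} (z : T ⟶ Bᘁ), (tensorRightHomEquiv T B (Bᘁ) (𝟙_ C)).symm
      (z ≫ (λ_ _).inv) = z ▷ B ≫ ε_ B (Bᘁ) := by
    intro B z
    simp only [tensorRightHomEquiv, Equiv.coe_fn_symm_mk]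
    monoidal
  have hyφ : y ▷ S.X₃ ≫ ε_ _ _ = φ := by
    rw [← key, hy]; simp
  have : (tensorRightHomEquiv T S.X₂ (S.X₂ᘁ) (𝟙_ C)).symm ((y ≫ (S.gᘁ)) ≫ (λ_ _).inv) =
      (tensorRightHomEquiv T S.X₂ (S.X₂ᘁ) (𝟙_ C)).symm (x ≫ (λ_ _).inv) := by
    rw [key, key, comp_whiskerRight_assoc, rightAdjointMate_comp_evaluation,
      ← whisker_exchange_assoc, hyφ, hφ]
  exact (cancel_mono _).1 ((tensorRightHomEquiv T S.X₂ (S.X₂ᘁ) (𝟙_ C)).symm.injective this)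

theorem mono_mate {S : ShortComplex C} (hS : S.ShortExact) : Mono (S.gᘁ) := by
  rw [Preadditive.mono_iff_cancel_zero]
  intro T x hx
  have hT := shortExact_tensorLeft T hS
  have : Epi (T ◁ S.g) := hT.epi_g
  have h0 : T ◁ S.g ≫ x ▷ S.X₃ ≫ ε_ S.X₃ (S.X₃ᘁ) = 0 := by
    rw [whisker_exchange_assoc, ← rightAdjointMate_comp_evaluation, ← comp_whiskerRight_assoc, hx]
    simp
  have h1 : x ▷ S.X₃ ≫ ε_ S.X₃ (S.X₃ᘁ) = 0 := by
    rw [← cancel_epi (T ◁ S.g), h0, comp_zero]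
  have key : (tensorRightHomEquiv T S.X₃ (S.X₃ᘁ) (𝟙_ C)).symm
      (x ≫ (λ_ _).inv) = x ▷ S.X₃ ≫ ε_ S.X₃ (S.X₃ᘁ) := by
    simp only [tensorRightHomEquiv, Equiv.coe_fn_symm_mk]
    monoidal
  rw [h1, Equiv.symm_apply_eq] at key
  have : x ≫ (λ_ (S.X₃ᘁ)).inv = 0 := by
    rw [key]; simp [tensorRightHomEquiv]
  simpa using this =≫ (λ_ _).hom

theorem mate_comp_zero (S : ShortComplex C) : (S.gᘁ) ≫ (S.fᘁ) = 0 := by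
  rw [← comp_rightAdjointMate, S.zero, mate_zero]

theorem loop_add {S : ShortComplex C} (hS : S.ShortExact) (f₁ : S.X₁ ⟶ S.X₁) (f₂ : S.X₂ ⟶ S.X₂)
    (f₃ : S.X₃ ⟶ S.X₃) (h₁ : S.f ≫ f₂ = f₁ ≫ S.f) (h₂ : S.g ≫ f₃ = f₂ ≫ S.g) :
    loop f₂ = loop f₁ + loop f₃ := by
  let ev (X : C) : X ⊗ Xᘁ ⟶ 𝟙_ C := (β_ X (Xᘁ)).hom ≫ ε_ X (Xᘁ)
  have hev : ∀ {X Y : C} (f : X ⟶ Y), f ▷ (Yᘁ) ≫ ev Y = X ◁ (fᘁ) ≫ ev X := by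
    intro X Y f
    simp only [ev]
    rw [BraidedCategory.braiding_naturality_left_assoc,
      BraidedCategory.braiding_naturality_right_assoc, rightAdjointMate_comp_evaluation]
  have hA := shortExact_tensorRight (S.X₁ᘁ) hS
  have hB := shortExact_tensorRight (S.X₂ᘁ) hS
  have hC := shortExact_tensorRight (S.X₃ᘁ) hS
  have monoA : Mono (S.f ▷ (S.X₁ᘁ)) := hA.mono_f
  have epiC : Epi (S.g ▷ (S.X₃ᘁ)) := hC.epi_g
  have : Mono (S.gᘁ) := mono_mate hS
  let D : ShortComplex C := ShortComplex.mk (S.gᘁ) (S.fᘁ) (mate_comp_zero S)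
  have hD : D.Exact := D.exact_of_f_is_kernel
    (KernelFork.IsLimit.ofι' _ _ fun x hx =>
      ⟨(exists_lift_mate hS x hx).choose, (exists_lift_mate hS x hx).choose_spec⟩)
  have hXR : (tensorLeft S.X₃).IsRightAdjoint := by
    exact (tensorLeftAdjunction S.X₃ (S.X₃ᘁ)).isRightAdjoint
  have hDC : (D.map (tensorLeft S.X₃)).Exact := by
    have : Mono D.f := this
    exact hD.map_of_mono_of_preservesKernel _ inferInstance inferInstance
  have monoD : Mono (S.X₃ ◁ (S.gᘁ)) := by
    have : Mono ((tensorLeft S.X₃).map (S.gᘁ)) := inferInstance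
    exact this
  let t : S.X₂ ⊗ (S.X₂ᘁ) ⟶ S.X₃ ⊗ (S.X₁ᘁ) := S.g ▷ _ ≫ _ ◁ (S.fᘁ)
  have ht : t = S.X₂ ◁ (S.fᘁ) ≫ S.g ▷ _ := (whisker_exchange _ _).symm
  let m := kernel.ι t
  have hm : m ≫ S.g ▷ _ ≫ S.X₃ ◁ (S.fᘁ) = 0 := kernel.condition t
  have hm' : m ≫ S.X₂ ◁ (S.fᘁ) ≫ S.g ▷ _ = 0 := by rw [← ht]; exact kernel.condition t
  have liftA : ∀ {T : C} {Z : C} (z : T ⟶ S.X₂ ⊗ Z), z ≫ S.g ▷ Z = 0 →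
      ∃ y : T ⟶ S.X₁ ⊗ Z, y ≫ S.f ▷ Z = z := by
    intro T Z z hz
    have h := shortExact_tensorRight Z hS
    have := h.mono_f
    exact ⟨h.exact.lift z hz, h.exact.lift_f z hz⟩
  obtain ⟨qA, hqA⟩ := liftA (m ≫ S.X₂ ◁ (S.fᘁ)) (by rw [Category.assoc, hm'])
  obtain ⟨qC, hqC⟩ : ∃ q : kernel t ⟶ S.X₃ ⊗ (S.X₃ᘁ), q ≫ S.X₃ ◁ (S.gᘁ) = m ≫ S.g ▷ _ := by
    have : Mono (D.map (tensorLeft S.X₃)).f := monoD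
    exact ⟨hDC.lift (m ≫ S.g ▷ _) ((Category.assoc _ _ _).trans hm), hDC.lift_f _ _⟩
  have hg0 : S.X₂ ◁ (S.gᘁ) ≫ S.X₂ ◁ (S.fᘁ) = 0 := by
    rw [← MonoidalCategory.whiskerLeft_comp, mate_comp_zero]; simp
  have hf0 : ∀ Z : C, S.f ▷ Z ≫ S.g ▷ Z = 0 := fun Z => by
    rw [← comp_whiskerRight, S.zero]; simp
  let uC : S.X₂ ⊗ (S.X₃ᘁ) ⟶ kernel t := kernel.lift t (S.X₂ ◁ (S.gᘁ)) (by
    rw [ht, reassoc_of% hg0, zero_comp])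
  let uA : S.X₁ ⊗ (S.X₂ᘁ) ⟶ kernel t := kernel.lift t (S.f ▷ _) (by
    rw [reassoc_of% (hf0 (S.X₂ᘁ)), zero_comp])
  have huC : uC ≫ m = S.X₂ ◁ (S.gᘁ) := kernel.lift_ι _ _ _
  have huA : uA ≫ m = S.f ▷ _ := kernel.lift_ι _ _ _
  have e1 : uC ≫ qA = 0 := by
    rw [← cancel_mono (S.f ▷ (S.X₁ᘁ)), Category.assoc, hqA, reassoc_of% huC, hg0, zero_comp]
  have e2 : uC ≫ qC = S.g ▷ _ := by
    rw [← cancel_mono (S.X₃ ◁ (S.gᘁ)), Category.assoc, hqC, reassoc_of% huC, whisker_exchange]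
  have e3 : uA ≫ qA = S.X₁ ◁ (S.fᘁ) := by
    rw [← cancel_mono (S.f ▷ (S.X₁ᘁ)), Category.assoc, hqA, reassoc_of% huA, whisker_exchange]
  have e4 : uA ≫ qC = 0 := by
    rw [← cancel_mono (S.X₃ ◁ (S.gᘁ)), Category.assoc, hqC, reassoc_of% huA, hf0, zero_comp]
  have hd : m ≫ ev S.X₂ = qA ≫ ev S.X₁ + qC ≫ ev S.X₃ := by
    rw [← sub_eq_zero]
    set d := m ≫ ev S.X₂ - (qA ≫ ev S.X₁ + qC ≫ ev S.X₃) with hd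
    have d1 : uC ≫ d = 0 := by
      rw [hd, Preadditive.comp_sub, Preadditive.comp_add, reassoc_of% huC, reassoc_of% e1,
        reassoc_of% e2, hev S.g]
      simp
    have d2 : uA ≫ d = 0 := by
      rw [hd, Preadditive.comp_sub, Preadditive.comp_add, reassoc_of% huA, reassoc_of% e3,
        reassoc_of% e4, hev S.f]
      simp
    have hq : Epi qC := by
      have : Epi (uC ≫ qC) := by rw [e2]; exact epiC
      exact epi_of_epi uC qC
    have d3 : kernel.ι qC ≫ d = 0 := by
      obtain ⟨w, hw⟩ := liftA (kernel.ι qC ≫ m) (by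
        rw [Category.assoc, ← hqC, kernel.condition_assoc, zero_comp])
      have : kernel.ι qC = w ≫ uA := by
        rw [← cancel_mono m, Category.assoc, huA, hw]
      rw [this, Category.assoc, d2, comp_zero]
    have d4 : qC ≫ Abelian.epiDesc qC d d3 = d := Abelian.comp_epiDesc _ _ _
    have d5 : S.g ▷ _ ≫ Abelian.epiDesc qC d d3 = 0 := by
      rw [← e2, Category.assoc, d4, d1]
    have d6 : Abelian.epiDesc qC d d3 = 0 := by
      rw [← cancel_epi (S.g ▷ (S.X₃ᘁ)), d5, comp_zero]
    rw [← d4, d6, comp_zero]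
  have c1 : η_ S.X₂ (S.X₂ᘁ) ≫ f₂ ▷ _ ≫ S.g ▷ _ =
      (η_ S.X₃ (S.X₃ᘁ) ≫ f₃ ▷ _) ≫ S.X₃ ◁ (S.gᘁ) := by
    rw [← comp_whiskerRight, ← h₂, comp_whiskerRight, ← coevaluation_comp_rightAdjointMate_assoc,
      whisker_exchange, Category.assoc]
  have c2 : η_ S.X₂ (S.X₂ᘁ) ≫ f₂ ▷ _ ≫ S.X₂ ◁ (S.fᘁ) =
      (η_ S.X₁ (S.X₁ᘁ) ≫ f₁ ▷ _) ≫ S.f ▷ _ := by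
    rw [← whisker_exchange, coevaluation_comp_rightAdjointMate_assoc, Category.assoc,
      ← comp_whiskerRight, ← comp_whiskerRight, h₁]
  have hl : (η_ S.X₂ (S.X₂ᘁ) ≫ f₂ ▷ _) ≫ t = 0 := by
    have := mate_comp_zero S
    simp only [t]
    rw [Category.assoc, reassoc_of% c1, ← MonoidalCategory.whiskerLeft_comp, this]
    simp
  let l := kernel.lift t _ hl
  have hlm : l ≫ m = η_ S.X₂ (S.X₂ᘁ) ≫ f₂ ▷ _ := kernel.lift_ι _ _ _
  have l1 : l ≫ qA = η_ S.X₁ (S.X₁ᘁ) ≫ f₁ ▷ _ := by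
    rw [← cancel_mono (S.f ▷ (S.X₁ᘁ)), Category.assoc, hqA, reassoc_of% hlm, c2]
  have l3 : l ≫ qC = η_ S.X₃ (S.X₃ᘁ) ≫ f₃ ▷ _ := by
    rw [← cancel_mono (S.X₃ ◁ (S.gᘁ)), Category.assoc, hqC, reassoc_of% hlm, c1]
  have := l ≫= hd
  rw [Preadditive.comp_add, reassoc_of% hlm, reassoc_of% l1, reassoc_of% l3] at this
  exact this

end Abelian

section Trace

variable (k : Type w) [Field k]
  (C : Type u) [Category.{v} C] [Abelian C] [Linear k C] [MonoidalCategory C]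

/-- The endomorphism ring of the unit object consists of the scalars: `a ↦ a • 1` is a bijection
from `k` onto `End(1)`. -/
class EndUnitIsScalar : Prop where
  bijective : Function.Bijective fun a : k => a • 𝟙 (𝟙_ C)

/-- The identification of `End(1)` with the ground field. -/
def unitScalar [EndUnitIsScalar k C] : (𝟙_ C ⟶ 𝟙_ C) ≃ₗ[k] k :=
  (LinearEquiv.ofBijective (LinearMap.toSpanSingleton k (𝟙_ C ⟶ 𝟙_ C) (𝟙 (𝟙_ C)))
    EndUnitIsScalar.bijective).symm

variable {C} [SymmetricCategory C] [RightRigidCategory C] [EndUnitIsScalar k C]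

/-- The trace of an endomorphism: the scalar `Tr(f)` with `loop f = Tr(f) • 1`. -/
def trace {X : C} (f : X ⟶ X) : k := unitScalar k C (loop f)

end Trace

section Grothendieck

variable (C : Type u) [Category.{v} C] [Abelian C] [MonoidalCategory C] [SymmetricCategory C]
  [RightRigidCategory C] [MonoidalPreadditive C]

/-- The isomorphism class of an object, as an element of the ring `ℤ[isomorphism classes]`, whose
product is induced by the tensor product. -/
def isoClass {C : Type u} [Category.{v} C] (X : C) : FreeAbelianGroup (Skeleton C) :=
  FreeAbelianGroup.of (toSkeleton X)

/-- The relations `[X₂] = [X₁] + [X₃]` for short exact sequences `0 → X₁ → X₂ → X₃ → 0`. -/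
def exactRelations : Set (FreeAbelianGroup (Skeleton C)) :=
  {r | ∃ S : ShortComplex C, S.ShortExact ∧ r = isoClass S.X₂ - (isoClass S.X₁ + isoClass S.X₃)}

theorem isoClass_mul (X Y : C) : isoClass X * isoClass Y = isoClass (X ⊗ Y) := by
  simp [isoClass, Skeleton.toSkeleton_tensorObj, FreeAbelianGroup.of_mul_of]

/-- The subgroup generated by the relations of short exact sequences. The tensor product being
exact, it is an ideal. -/
def exactIdeal : Ideal (FreeAbelianGroup (Skeleton C)) where
  toAddSubmonoid := (AddSubgroup.closure (exactRelations C)).toAddSubmonoid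
  smul_mem' := by
    intro c x hx
    change c * x ∈ AddSubgroup.closure (exactRelations C)
    replace hx : x ∈ AddSubgroup.closure (exactRelations C) := hx
    induction c using FreeAbelianGroup.induction_on with
    | zero => rw [zero_mul]; exact zero_mem _
    | of X =>
      induction X using Quotient.inductionOn with
      | _ X =>
      change isoClass X * x ∈ _
      induction hx using AddSubgroup.closure_induction with
      | mem x hx =>
        obtain ⟨S, hS, rfl⟩ := hx
        refine AddSubgroup.subset_closure ⟨_, shortExact_tensorLeft X hS, ?_⟩
        simp only [mul_sub, mul_add, isoClass_mul]
        rfl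
      | zero => rw [mul_zero]; exact zero_mem _
      | add x y _ _ h₁ h₂ => rw [mul_add]; exact add_mem h₁ h₂
      | neg x _ h => rw [mul_neg]; exact neg_mem h
    | neg X h => rw [neg_mul]; exact neg_mem h
    | add a b h₁ h₂ => rw [add_mul]; exact add_mem h₁ h₂

/-- The Grothendieck ring of `C`. -/
abbrev K0 : Type u := FreeAbelianGroup (Skeleton C) ⧸ exactIdeal C

variable {C}

/-- The class of an object in the Grothendieck ring. -/
def K0.cls (X : C) : K0 C := Ideal.Quotient.mk (exactIdeal C) (isoClass X)

/-- The class in the Grothendieck ring of a virtual object, that is, of a formal integral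
combination of objects. -/
def K0.ofVirtual : FreeAbelianGroup C →+ K0 C := FreeAbelianGroup.lift K0.cls

/-- Every element of the Grothendieck ring is the class of a virtual object. -/
theorem K0.ofVirtual_surjective : Function.Surjective (K0.ofVirtual (C := C)) := by
  intro x
  obtain ⟨y, rfl⟩ := Ideal.Quotient.mk_surjective x
  induction y using FreeAbelianGroup.induction_on with
  | zero => exact ⟨0, by simp⟩
  | of X =>
    induction X using Quotient.inductionOn with
    | _ X => exact ⟨FreeAbelianGroup.of X, by simp [K0.ofVirtual]; rfl⟩
  | neg X h => obtain ⟨a, ha⟩ := h; exact ⟨-a, by rw [map_neg, ha, map_neg]⟩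
  | add a b h₁ h₂ =>
    obtain ⟨a', ha⟩ := h₁
    obtain ⟨b', hb⟩ := h₂
    exact ⟨a' + b', by rw [map_add, ha, hb, map_add]⟩

theorem K0.cls_congr {X Y : C} (e : X ≅ Y) : K0.cls X = K0.cls Y := by
  unfold K0.cls isoClass
  rw [congr_toSkeleton_of_iso e]

variable (k : Type w) [Field k] [Linear k C] [EndUnitIsScalar k C]

theorem trace_congr (g : 𝟭 C ⟶ 𝟭 C) {X Y : C} (e : X ≅ Y) :
    trace k (X := X) (g.app X) = trace k (X := Y) (g.app Y) := by
  have h : e.hom ≫ g.app Y = g.app X ≫ e.hom := g.naturality e.hom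
  have hX : g.app X = (e.hom ≫ g.app Y) ≫ e.inv := by rw [h]; simp
  unfold trace
  rw [hX]
  exact congrArg _ ((loop_comm (e.hom ≫ g.app Y) e.inv).trans (by simp))

/-- The function `[X] ↦ Tr(g_X)` on isomorphism classes of objects. -/
def isoTrace (g : 𝟭 C ⟶ 𝟭 C) : Skeleton C → k :=
  Quotient.lift (fun X : C => trace k (X := X) (g.app X)) fun _ _ ⟨e⟩ => trace_congr k g e

theorem isoTrace_add (g : 𝟭 C ⟶ 𝟭 C) {S : ShortComplex C} (hS : S.ShortExact) :
    isoTrace k g (toSkeleton S.X₂) =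
      isoTrace k g (toSkeleton S.X₁) + isoTrace k g (toSkeleton S.X₃) := by
  have h : loop _ = _ + _ := loop_add hS (g.app _) (g.app _) (g.app _) (g.naturality S.f)
    (g.naturality S.g)
  exact (congrArg (unitScalar k C) h).trans (map_add _ _ _)

theorem exactIdeal_le_ker (g : 𝟭 C ⟶ 𝟭 C) :
    (exactIdeal C).toAddSubgroup ≤ (FreeAbelianGroup.lift (isoTrace k g)).ker := by
  have : AddSubgroup.closure (exactRelations C) ≤ (FreeAbelianGroup.lift (isoTrace k g)).ker := by
    rw [AddSubgroup.closure_le]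
    rintro _ ⟨S, hS, rfl⟩
    simp [isoClass, isoTrace_add k g hS]
  exact this

/-- For an endomorphism `g` of the identity functor, the additive map `x ↦ Tr(g_x)` on the
Grothendieck group with `Tr(g_x) = Tr(g_X)` for the class `x` of an object `X`. -/
def K0.trace (g : 𝟭 C ⟶ 𝟭 C) : K0 C →+ k :=
  QuotientAddGroup.lift (exactIdeal C).toAddSubgroup (FreeAbelianGroup.lift (isoTrace k g))
    (exactIdeal_le_ker k g)

theorem K0.trace_cls (g : 𝟭 C ⟶ 𝟭 C) (X : C) :
    K0.trace k g (K0.cls X) = TensorCat.trace k (X := X) (g.app X) := by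
  change FreeAbelianGroup.lift (isoTrace k g) (isoClass X) = _
  simp only [isoClass, FreeAbelianGroup.lift_apply_of]
  rfl

end Grothendieck

section Exterior

variable {C : Type u} [Category.{v} C] [Abelian C] [MonoidalCategory C] [SymmetricCategory C]

/-- The tensor power `X ⊗ (X ⊗ (⋯ ⊗ 1))` with `n` factors `X`. -/
def tensorPow (X : C) : ℕ → C
  | 0 => 𝟙_ C
  | n + 1 => X ⊗ tensorPow X n

/-- The action on `X^{⊗n}` of the transposition of the adjacent factors `i` and `i + 1`, counted
from `0`; the junk value outside the range `i + 1 < n` is the identity. -/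
def adjSwap (X : C) : (n : ℕ) → (i : ℕ) → (tensorPow X n ⟶ tensorPow X n)
  | n + 2, 0 => (α_ X X (tensorPow X n)).inv ≫ (β_ X X).hom ▷ tensorPow X n ≫
      (α_ X X (tensorPow X n)).hom
  | n + 1, i + 1 => X ◁ adjSwap X n i
  | 1, 0 => 𝟙 _
  | 0, _ => 𝟙 _

/-- The exterior power `Λⁿ X = Hom_{S_n}(sign, X^{⊗n})`: the largest subobject of `X^{⊗n}` on which
`S_n` acts through the sign character. As the adjacent transpositions generate `S_n`, this is the
common kernel of the morphisms `1 + sᵢ`, `0 ≤ i < n - 1`. -/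
def exteriorPower (X : C) (n : ℕ) : C :=
  kernel (Pi.lift fun i : Fin (n - 1) => 𝟙 (tensorPow X n) + adjSwap X n i)

/-- `Λ⁰ X` is the unit object. -/
def exteriorPowerZero (X : C) : exteriorPower X 0 ≅ 𝟙_ C :=
  haveI : IsEmpty (Fin (0 - 1)) := inferInstanceAs (IsEmpty (Fin 0))
  haveI h : Pi.lift (fun i : Fin (0 - 1) => 𝟙 (tensorPow X 0) + adjSwap X 0 i) = 0 :=
    Pi.hom_ext _ _ fun i => isEmptyElim i
  kernelIsoOfEq h ≪≫ kernelZeroIsoSource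

end Exterior

section Adams

variable {C : Type u} [Category.{v} C] [Abelian C] [MonoidalCategory C] [SymmetricCategory C]
  [RightRigidCategory C] [MonoidalPreadditive C]

open PowerSeries

/-- The series `λ_t([X]) = ∑ [Λⁿ X] tⁿ` of an object. -/
def exteriorSeries (X : C) : (K0 C)⟦X⟧ := PowerSeries.mk fun n => K0.cls (exteriorPower X n)

theorem isUnit_exteriorSeries (X : C) : IsUnit (exteriorSeries X) := by
  rw [PowerSeries.isUnit_iff_constantCoeff]
  have : constantCoeff (exteriorSeries X) = 1 := by
    simp only [exteriorSeries, ← coeff_zero_eq_constantCoeff_apply, coeff_mk]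
    rw [K0.cls_congr (exteriorPowerZero X)]
    rfl
  rw [this]
  exact isUnit_one

/-- The series `λ_t`, extended from objects to virtual objects by `λ_t(x + y) = λ_t(x) λ_t(y)`. -/
def lambdaSeries : FreeAbelianGroup C →+ Additive ((K0 C)⟦X⟧)ˣ :=
  FreeAbelianGroup.lift fun X => Additive.ofMul (isUnit_exteriorSeries X).unit

/-- The series `ψ_t(x) = ∑ ψⁿ(x) tⁿ` of Adams operations, determined by
`ψ_{-t}(x) = -t λ_t'(x) / λ_t(x)`. -/
def adamsSeries (x : FreeAbelianGroup C) : (K0 C)⟦X⟧ :=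
  evalNegHom (-X * d⁄dX (K0 C) ((lambdaSeries x).toMul : (K0 C)⟦X⟧) *
    (((lambdaSeries x).toMul⁻¹ : ((K0 C)⟦X⟧)ˣ) : (K0 C)⟦X⟧))

/-- The Adams operation `ψⁿ`, `n ≥ 1`. -/
def adams (n : ℕ) (x : FreeAbelianGroup C) : K0 C := coeff n (adamsSeries x)

end Adams

end TensorCat

end

/-!
Put `χ = (x ↦ Tr(g_x))`. Since `g` is monoidal, `χ` is a ring homomorphism `K₀(C) → k`
(`K0.traceHom`), and both sides of the claim are additive in the virtual object (`adamsHom`), so it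
suffices to treat an object `X`. Unfolding the logarithmic derivative that defines the Adams
operations, the claim becomes Newton's identities between `eₙ = Tr(g on Λⁿ X)` and
`pₙ = Tr(g_Xⁿ)` (`newton_identity`, `trace_adams_of`).

These are proved by means of partial traces. In characteristic zero `Λⁿ X` is the image of the
antisymmetrizer `Aₙ` on `X^{⊗n}`, so that `eₙ = Tr(Aₙ g)` (`trace_exteriorPower`). Taking the partial
trace of `(n + 1) Aₙ₊₁ g` over all factors but the first yields an endomorphism `Qₙ` of `X` of trace
`(n + 1) eₙ₊₁`. The recursion `(n + 1) Aₙ₊₁ = B - n B s₀ B` with `B = 1 ⊗ Aₙ`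
(`antisymmetrizer_recursion`), the cyclicity of the partial trace and the fact that the partial
trace of the exchange of two factors is the identity give `Qₙ = eₙ g_X - Qₙ₋₁ g_X`
(`hookTrace_succ`), whence `Qₙ = ∑ (-1)^j eₙ₋ⱼ g_X^(j+1)`; the trace of this equation is Newton's
identity.

The antisymmetrizer is built recursively from sums over coset representatives, so that only the
Coxeter relations of the adjacent transpositions enter and no action of the whole symmetric group has
to be constructed.
-/

open CategoryTheory CategoryTheory.Limits CategoryTheory.MonoidalCategory

noncomputable section

namespace TensorCat

universe w v u

/-! ### Partial traces in symmetric monoidal categories -/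

section PartialTrace

variable {C : Type u} [Category.{v} C] [MonoidalCategory C] [SymmetricCategory C]

/-- The evaluation of an exact pairing `(Y, Y')` with its arguments exchanged. -/
def cap (Y Y' : C) [ExactPairing Y Y'] : Y ⊗ Y' ⟶ 𝟙_ C := (β_ Y Y').hom ≫ ε_ Y Y'

/-- The partial trace `A ⟶ B` of a morphism `A ⊗ Y ⟶ B ⊗ Y`, the loop being closed by means of a
given dual `Y'` of `Y`. -/
def ptr {A B : C} (Y Y' : C) [ExactPairing Y Y'] (h : A ⊗ Y ⟶ B ⊗ Y) : A ⟶ B :=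
  (ρ_ A).inv ≫ A ◁ η_ Y Y' ≫ (α_ A Y Y').inv ≫ h ▷ Y' ≫ (α_ B Y Y').hom ≫ B ◁ cap Y Y' ≫ (ρ_ B).hom

variable {A B D : C}

theorem ptr_comp_left (Y Y' : C) [ExactPairing Y Y'] (f : A ⟶ B) (h : B ⊗ Y ⟶ D ⊗ Y) :
    ptr Y Y' (f ▷ Y ≫ h) = f ≫ ptr Y Y' h := by
  unfold ptr
  calc
    _ = (ρ_ A).inv ≫ (A ◁ η_ Y Y' ≫ f ▷ (Y ⊗ Y')) ≫ (α_ B Y Y').inv ≫ h ▷ Y' ≫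
        (α_ D Y Y').hom ≫ D ◁ cap Y Y' ≫ (ρ_ D).hom := by monoidal
    _ = _ := by rw [whisker_exchange]; monoidal

theorem ptr_comp_right (Y Y' : C) [ExactPairing Y Y'] (h : A ⊗ Y ⟶ B ⊗ Y) (f : B ⟶ D) :
    ptr Y Y' (h ≫ f ▷ Y) = ptr Y Y' h ≫ f := by
  unfold ptr
  calc
    _ = (ρ_ A).inv ≫ A ◁ η_ Y Y' ≫ (α_ A Y Y').inv ≫ h ▷ Y' ≫ (α_ B Y Y').hom ≫
        (f ▷ (Y ⊗ Y') ≫ D ◁ cap Y Y') ≫ (ρ_ D).hom := by monoidal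
    _ = _ := by rw [← whisker_exchange]; monoidal

/-- Every morphism has a mate with respect to given pairings of its source and target. -/
theorem exists_mate {Y Y' Z Z' : C} [ExactPairing Y Y'] [ExactPairing Z Z'] (a : Y ⟶ Z) :
    ∃ a' : Z' ⟶ Y', η_ Z Z' ≫ Z ◁ a' = η_ Y Y' ≫ a ▷ Y' ∧ a' ▷ Y ≫ ε_ Y Y' = Z' ◁ a ≫ ε_ Z Z' := by
  let _ : HasRightDual Y := ⟨Y'⟩
  let _ : HasRightDual Z := ⟨Z'⟩
  exact ⟨aᘁ, coevaluation_comp_rightAdjointMate a, rightAdjointMate_comp_evaluation a⟩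

/-- The partial trace is cyclic in the traced factor. With `a` an identity this says that it does
not depend on the choice of the dual. -/
theorem ptr_cyclic {Y Y' Z Z' : C} [ExactPairing Y Y'] [ExactPairing Z Z'] (a : Y ⟶ Z)
    (h : A ⊗ Z ⟶ B ⊗ Y) : ptr Y Y' (A ◁ a ≫ h) = ptr Z Z' (h ≫ B ◁ a) := by
  obtain ⟨a', h₁, h₂⟩ := exists_mate (Y' := Y') (Z' := Z') a
  have h₃ : a ▷ Z' ≫ cap Z Z' = Y ◁ a' ≫ cap Y Y' := by
    unfold cap
    rw [BraidedCategory.braiding_naturality_left_assoc,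
      BraidedCategory.braiding_naturality_right_assoc, h₂]
  unfold ptr
  calc
    _ = (ρ_ A).inv ≫ A ◁ (η_ Y Y' ≫ a ▷ Y') ≫ (α_ A Z Y').inv ≫ h ▷ Y' ≫ (α_ B Y Y').hom ≫
        B ◁ cap Y Y' ≫ (ρ_ B).hom := by monoidal
    _ = (ρ_ A).inv ≫ A ◁ η_ Z Z' ≫ (α_ A Z Z').inv ≫ ((A ⊗ Z) ◁ a' ≫ h ▷ Y') ≫ (α_ B Y Y').hom ≫
        B ◁ cap Y Y' ≫ (ρ_ B).hom := by rw [← h₁]; monoidal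
    _ = (ρ_ A).inv ≫ A ◁ η_ Z Z' ≫ (α_ A Z Z').inv ≫ h ▷ Z' ≫ (α_ B Y Z').hom ≫
        B ◁ (Y ◁ a' ≫ cap Y Y') ≫ (ρ_ B).hom := by rw [whisker_exchange]; monoidal
    _ = _ := by rw [← h₃]; monoidal

theorem ptr_eq_of_pairing {Y Y' Y'' : C} (p : ExactPairing Y Y') (q : ExactPairing Y Y'')
    (h : A ⊗ Y ⟶ B ⊗ Y) : ptr Y Y' h = ptr Y Y'' h := by
  simpa using ptr_cyclic (Y' := Y') (Z' := Y'') (𝟙 Y) h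

theorem ptr_whiskerLeft (X Y Y' : C) [ExactPairing Y Y'] (h : A ⊗ Y ⟶ B ⊗ Y) :
    ptr Y Y' ((α_ X A Y).hom ≫ X ◁ h ≫ (α_ X B Y).inv) = X ◁ ptr Y Y' h := by
  unfold ptr
  monoidal

/-- The partial trace of the exchange of factors is the identity. -/
theorem ptr_braiding (Y Y' : C) [ExactPairing Y Y'] : ptr Y Y' (β_ Y Y).hom = 𝟙 Y := by
  have h : (α_ Y Y Y').inv ≫ (β_ Y Y).hom ▷ Y' ≫ (α_ Y Y Y').hom ≫ Y ◁ (β_ Y Y').hom =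
      (β_ Y (Y ⊗ Y')).hom ≫ (α_ Y Y' Y).hom := by
    rw [BraidedCategory.braiding_tensor_right_hom]
    simp
  unfold ptr cap
  rw [MonoidalCategory.whiskerLeft_comp, Category.assoc, reassoc_of% h,
    BraidedCategory.braiding_naturality_right_assoc]
  simp

theorem ptr_braiding_comp (Y Y' : C) [ExactPairing Y Y'] (f : Y ⟶ Y) :
    ptr Y Y' ((β_ Y Y).hom ≫ Y ◁ f) = f := by
  rw [← BraidedCategory.braiding_naturality_left, ptr_comp_left, ptr_braiding, Category.comp_id]

/-- The cap of a tensor product consists of two nested caps. -/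
theorem cap_tensor (Y Y' Z Z' : C) [ExactPairing Y Y'] [ExactPairing Z Z'] :
    cap (Y ⊗ Z) (Z' ⊗ Y') = 𝟙 _ ⊗≫ Y ◁ cap Z Z' ▷ Y' ⊗≫ cap Y Y' := by
  -- A strand `Z` is moved across the cap of `Y`, by naturality of the braiding.
  have e₁ : Y ◁ (β_ Z Y').hom ⊗≫ cap Y Y' ▷ Z = 𝟙 _ ⊗≫ (β_ Y Z).hom ▷ Y' ⊗≫ Z ◁ cap Y Y' ⊗≫ 𝟙 (𝟙_ C ⊗ Z) := by
    have h := BraidedCategory.braiding_naturality_right Z (cap Y Y')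
    rw [BraidedCategory.braiding_tensor_right_hom, braiding_tensorUnit_right] at h
    calc
      _ = 𝟙 (Y ⊗ Z ⊗ Y') ⊗≫ ((β_ Y Z).hom ≫ (β_ Z Y).hom) ▷ Y' ⊗≫ Y ◁ (β_ Z Y').hom ⊗≫
          cap Y Y' ▷ Z := by
        rw [SymmetricCategory.symmetry]; monoidal
      _ = 𝟙 (Y ⊗ Z ⊗ Y') ⊗≫ (β_ Y Z).hom ▷ Y' ⊗≫ (((α_ Z Y Y').inv ≫ (β_ Z Y).hom ▷ Y' ≫
          (α_ Y Z Y').hom ≫ Y ◁ (β_ Z Y').hom ≫ (α_ Y Y' Z).inv) ≫ cap Y Y' ▷ Z) ⊗≫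
          𝟙 (𝟙_ C ⊗ Z) := by monoidal
      _ = _ := by rw [← h]; monoidal
  -- A strand `Y` is moved across the evaluation of `Z`.
  have e₂ : (β_ Y Z').hom ▷ Z ⊗≫ Z' ◁ (β_ Y Z).hom ⊗≫ ε_ Z Z' ▷ Y =
      𝟙 _ ⊗≫ Y ◁ ε_ Z Z' ⊗≫ 𝟙 _ := by
    have h := BraidedCategory.braiding_naturality_right Y (ε_ Z Z')
    rw [BraidedCategory.braiding_tensor_right_hom, braiding_tensorUnit_right] at h
    calc
      _ = 𝟙 _ ⊗≫ (((α_ Y Z' Z).inv ≫ (β_ Y Z').hom ▷ Z ≫ (α_ Z' Y Z).hom ≫ Z' ◁ (β_ Y Z).hom ≫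
          (α_ Z' Z Y).inv) ≫ ε_ Z Z' ▷ Y) ⊗≫ 𝟙 _ := by monoidal
      _ = _ := by rw [← h]; monoidal
  have e₀ : ε_ (Y ⊗ Z) (Z' ⊗ Y') = 𝟙 _ ⊗≫ Z' ◁ (ε_ Y Y' ▷ Z) ⊗≫ ε_ Z Z' :=
    ExactPairing.tensor_evaluation
  unfold cap
  rw [e₀, BraidedCategory.braiding_tensor_right_hom, BraidedCategory.braiding_tensor_left_hom,
    BraidedCategory.braiding_tensor_left_hom]
  calc
    _ = 𝟙 _ ⊗≫ Y ◁ (β_ Z Z').hom ▷ Y' ⊗≫ (β_ Y Z').hom ▷ Z ▷ Y' ⊗≫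
        Z' ◁ (Y ◁ (β_ Z Y').hom ⊗≫ cap Y Y' ▷ Z) ⊗≫ ε_ Z Z' := by
      unfold cap; monoidal
    _ = 𝟙 _ ⊗≫ Y ◁ (β_ Z Z').hom ▷ Y' ⊗≫ (β_ Y Z').hom ▷ Z ▷ Y' ⊗≫
        Z' ◁ (β_ Y Z).hom ▷ Y' ⊗≫ ((Z' ⊗ Z) ◁ cap Y Y' ≫ ε_ Z Z' ▷ _) ⊗≫ 𝟙 _ := by
      rw [e₁]; monoidal
    _ = 𝟙 _ ⊗≫ Y ◁ (β_ Z Z').hom ▷ Y' ⊗≫ ((β_ Y Z').hom ▷ Z ⊗≫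
        Z' ◁ (β_ Y Z).hom ⊗≫ ε_ Z Z' ▷ Y) ▷ Y' ⊗≫ cap Y Y' ⊗≫ 𝟙 _ := by
      rw [whisker_exchange]; monoidal
    _ = _ := by rw [e₂]; unfold cap; monoidal

/-- The partial trace over a tensor product is the iterated partial trace. -/
theorem ptr_tensor (Y Y' Z Z' : C) [ExactPairing Y Y'] [ExactPairing Z Z']
    (h : A ⊗ (Y ⊗ Z) ⟶ B ⊗ (Y ⊗ Z)) :
    ptr (Y ⊗ Z) (Z' ⊗ Y') h = ptr Y Y' (ptr Z Z' ((α_ A Y Z).hom ≫ h ≫ (α_ B Y Z).inv)) := by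
  have e₀ : η_ (Y ⊗ Z) (Z' ⊗ Y') = η_ Y Y' ⊗≫ (Y ◁ η_ Z Z') ▷ Y' ⊗≫ 𝟙 _ :=
    ExactPairing.tensor_coevaluation
  unfold ptr
  rw [e₀, cap_tensor]
  monoidal

variable [RightRigidCategory C]

theorem loop_eq_ptr {Z : C} (f : Z ⟶ Z) :
    loop f = ptr Z (Zᘁ) ((λ_ Z).hom ≫ f ≫ (λ_ Z).inv) := by
  unfold loop ptr cap
  monoidal

/-- The loop of an endomorphism of `X ⊗ Y` is computed by first tracing out `Y`. -/
theorem loop_tensor (X Y : C) (h : X ⊗ Y ⟶ X ⊗ Y) :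
    loop h = loop (ptr Y (Yᘁ) h) := by
  rw [loop_eq_ptr, loop_eq_ptr, ptr_eq_of_pairing inferInstance
    (ExactPairing.tensor (Y₁ := (Xᘁ : C)) (Y₂ := (Yᘁ : C))), ptr_tensor]
  congr 1
  rw [← ptr_comp_right, ← ptr_comp_left]
  congr 1
  monoidal

theorem loop_unit (f : 𝟙_ C ⟶ 𝟙_ C) : loop f = f := by
  rw [loop_eq_ptr, ptr_eq_of_pairing _ exactPairingUnit]
  have h₁ : η_ (𝟙_ C) (𝟙_ C) = (ρ_ _).inv := rfl
  have h₂ : ε_ (𝟙_ C) (𝟙_ C) = (ρ_ _).hom := rfl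
  unfold ptr cap
  rw [h₁, h₂, braiding_tensorUnit_right]
  monoidal

theorem ptr_whiskerLeft_right (X Y : C) (m : Y ⟶ Y) :
    ptr Y (Yᘁ) (X ◁ m) = (ρ_ X).inv ≫ X ◁ loop m ≫ (ρ_ X).hom := by
  unfold ptr loop cap
  monoidal

end PartialTrace

/-! ### The exchange of adjacent factors -/

section Exchange

variable {C : Type u} [Category.{v} C] [MonoidalCategory C] [SymmetricCategory C]

/-- The exchange of the first two factors of `X ⊗ (X ⊗ T)`. -/
def exch (X T : C) : X ⊗ X ⊗ T ⟶ X ⊗ X ⊗ T :=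
  (α_ X X T).inv ≫ (β_ X X).hom ▷ T ≫ (α_ X X T).hom

theorem exch_exch (X T : C) : exch X T ≫ exch X T = 𝟙 _ := by
  simp [exch, ← comp_whiskerRight_assoc]

theorem exch_naturality (X : C) {T T' : C} (m : T ⟶ T') :
    exch X T ≫ X ◁ X ◁ m = X ◁ X ◁ m ≫ exch X T' := by
  unfold exch
  calc
    _ = (α_ X X T).inv ≫ ((β_ X X).hom ▷ T ≫ (X ⊗ X) ◁ m) ≫ (α_ X X T').hom := by monoidal
    _ = _ := by rw [← whisker_exchange]; monoidal

theorem exch_braid (X T : C) :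
    exch X (X ⊗ T) ≫ X ◁ exch X T ≫ exch X (X ⊗ T) =
      X ◁ exch X T ≫ exch X (X ⊗ T) ≫ X ◁ exch X T := by
  have h := BraidedCategory.yang_baxter X X X
  unfold exch
  calc
    _ = X ◁ (α_ X X T).inv ≫ (α_ X (X ⊗ X) T).inv ≫
        ((α_ X X X).inv ≫ (β_ X X).hom ▷ X ≫ (α_ X X X).hom ≫ X ◁ (β_ X X).hom ≫ (α_ X X X).inv ≫
          (β_ X X).hom ▷ X ≫ (α_ X X X).hom) ▷ T ≫ (α_ X (X ⊗ X) T).hom ≫ X ◁ (α_ X X T).hom := by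
      monoidal
    _ = _ := by rw [h]; monoidal

/-- Tracing out all factors but the first after an exchange of the first two. -/
theorem ptr_exch_comp (X T X' T' : C) [ExactPairing X X'] [ExactPairing T T']
    (m : X ⊗ T ⟶ X ⊗ T) :
    ptr (X ⊗ T) (T' ⊗ X') (exch X T ≫ X ◁ m) = ptr T T' m := by
  have h : (α_ X X T).hom ≫ (exch X T ≫ X ◁ m) ≫ (α_ X X T).inv =
      (β_ X X).hom ▷ T ≫ (α_ X X T).hom ≫ X ◁ m ≫ (α_ X X T).inv := by simp [exch]
  rw [ptr_tensor, h, ptr_comp_left, ptr_whiskerLeft, ptr_braiding_comp]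

end Exchange

/-! ### The antisymmetrizer -/

section Antisymmetrizer

variable (k : Type w) [Field k] {C : Type u} [Category.{v} C] [Abelian C] [Linear k C]
  [MonoidalCategory C] [SymmetricCategory C] [MonoidalPreadditive C] [MonoidalLinear k C]

/-- The endomorphism of `X^{⊗n}` given by `adjSwap`, as an element `sᵢ` of the endomorphism algebra,
whose product is `a * b = b ≫ a`. -/
def swapEnd (X : C) (n i : ℕ) : End (tensorPow X n) := adjSwap X n i

/-- The embedding `m ↦ 1 ⊗ m` of the endomorphism algebra of `X^{⊗n}` into that of
`X^{⊗(n + 1)}`. -/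
def whiskerEnd (X : C) (n : ℕ) : End (tensorPow X n) →ₐ[k] End (tensorPow X (n + 1)) :=
  AlgHom.ofLinearMap
    { toFun := fun m => (X ◁ m : X ⊗ tensorPow X n ⟶ X ⊗ tensorPow X n)
      map_add' := fun _ _ => MonoidalPreadditive.whiskerLeft_add _ _
      map_smul' := fun _ _ => MonoidalLinear.whiskerLeft_smul _ _ _ }
    (MonoidalCategory.whiskerLeft_id X (tensorPow X n))
    (fun a b => MonoidalCategory.whiskerLeft_comp X b a)

variable (X : C)

theorem whiskerEnd_swapEnd (n i : ℕ) :
    whiskerEnd k X n (swapEnd X n i) = swapEnd X (n + 1) (i + 1) := by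
  cases n with
  | zero => cases i <;> rfl
  | succ n => rfl

theorem swapEnd_zero_mul_self (n : ℕ) : swapEnd X (n + 2) 0 * swapEnd X (n + 2) 0 = 1 :=
  exch_exch X (tensorPow X n)

theorem swapEnd_braid (n : ℕ) :
    swapEnd X (n + 3) 0 * swapEnd X (n + 3) 1 * swapEnd X (n + 3) 0 =
      swapEnd X (n + 3) 1 * swapEnd X (n + 3) 0 * swapEnd X (n + 3) 1 :=
  exch_braid X (tensorPow X n)

theorem whiskerEnd_whiskerEnd_mul_swapEnd (n : ℕ) (m : End (tensorPow X n)) :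
    whiskerEnd k X (n + 1) (whiskerEnd k X n m) * swapEnd X (n + 2) 0 =
      swapEnd X (n + 2) 0 * whiskerEnd k X (n + 1) (whiskerEnd k X n m) :=
  exch_naturality X m

/-- The signed sum `1 - s₀ + s₁s₀ - ⋯ ± sₙ₋₂⋯s₁s₀` on `X^{⊗n}` over representatives of the left
cosets in `Sₙ` of the stabilizer `Sₙ₋₁` of the first factor; the sum is `0` for `n = 0`. -/
def cosetSum : (n : ℕ) → End (tensorPow X n)
  | 0 => 0
  | n + 1 => 1 - whiskerEnd k X n (cosetSum n) * swapEnd X (n + 1) 0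

/-- The antisymmetrizer `(1 / n!) ∑ sign(σ) σ` on `X^{⊗n}`: that of `Sₙ₊₁` is the product of the
signed sum over coset representatives and the antisymmetrizer of `Sₙ`, divided by `n + 1`. -/
def antisymmetrizer : (n : ℕ) → End (tensorPow X n)
  | 0 => 1
  | n + 1 => ((n + 1 : k)⁻¹) • (cosetSum k X (n + 1) * whiskerEnd k X n (antisymmetrizer n))

section Alternating

variable {k X} {R M : Type*} [Ring R] [Algebra k R] [AddCommGroup M] [Module R M] {n : ℕ}

/-- The adjacent transpositions, and hence `Sₙ`, act by the sign character on the element `m` of a module, the action being through a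
homomorphism `ω` from the endomorphism algebra of `X^{⊗n}`. -/
def IsAlternating (ω : End (tensorPow X n) →ₐ[k] R) (m : M) : Prop :=
  ∀ i, i + 1 < n → ω (swapEnd X n i) • m = -m

theorem IsAlternating.whisker {ω : End (tensorPow X (n + 1)) →ₐ[k] R} {m : M}
    (h : IsAlternating ω m) : IsAlternating (ω.comp (whiskerEnd k X n)) m := by
  intro i hi
  rw [AlgHom.comp_apply, whiskerEnd_swapEnd]
  exact h _ (by omega)

theorem IsAlternating.cosetSum_smul {ω : End (tensorPow X n) →ₐ[k] R} {m : M}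
    (h : IsAlternating ω m) : ω (cosetSum k X n) • m = n • m := by
  induction n with
  | zero => simp [cosetSum]
  | succ n ih =>
    have h₁ := ih h.whisker
    rw [AlgHom.comp_apply] at h₁
    have h₂ : ω (whiskerEnd k X n (cosetSum k X n)) • ω (swapEnd X (n + 1) 0) • m = -(n • m) := by
      cases n with
      | zero => simp [cosetSum]
      | succ n => rw [h 0 (by omega), smul_neg, h₁]
    rw [cosetSum, map_sub, map_mul, map_one, sub_smul, one_smul, mul_smul, h₂, succ_nsmul]
    abel

variable [CharZero k]

theorem smul_antisymmetrizer_succ (n : ℕ) :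
    (n + 1 : k) • antisymmetrizer k X (n + 1) =
      cosetSum k X (n + 1) * whiskerEnd k X n (antisymmetrizer k X n) := by
  rw [antisymmetrizer, smul_smul, mul_inv_cancel₀ (Nat.cast_add_one_ne_zero n), one_smul]

theorem IsAlternating.antisymmetrizer_smul {ω : End (tensorPow X n) →ₐ[k] R} {m : M}
    (h : IsAlternating ω m) : ω (antisymmetrizer k X n) • m = m := by
  induction n with
  | zero => rw [antisymmetrizer, map_one, one_smul]
  | succ n ih =>
    have h₁ := ih h.whisker
    rw [AlgHom.comp_apply] at h₁
    have h₀ : (n + 1 : k) ≠ 0 := Nat.cast_add_one_ne_zero n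
    rw [antisymmetrizer, map_smul, map_mul, Algebra.smul_def, mul_smul, mul_smul, h₁,
      h.cosetSum_smul, ← Nat.cast_smul_eq_nsmul R, ← mul_smul]
    have : (algebraMap k R) (n + 1 : k)⁻¹ * ((n + 1 : ℕ) : R) = 1 := by
      rw [← map_natCast (algebraMap k R), ← map_mul, Nat.cast_add_one, inv_mul_cancel₀ h₀, map_one]
    rw [this, one_smul]

end Alternating

variable {k X} [CharZero k]

theorem antisymmetrizer_mul_self_of_isAlternating {n : ℕ}
    (h : IsAlternating (R := End (tensorPow X n)) (AlgHom.id k _) (antisymmetrizer k X n)) :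
    antisymmetrizer k X n * antisymmetrizer k X n = antisymmetrizer k X n :=
  h.antisymmetrizer_smul

theorem whiskerEnd_antisymmetrizer_mul_of_isAlternating {n : ℕ}
    (h : IsAlternating (R := End (tensorPow X (n + 1))) (AlgHom.id k _)
      (antisymmetrizer k X (n + 1))) :
    whiskerEnd k X n (antisymmetrizer k X n) * antisymmetrizer k X (n + 1) =
      antisymmetrizer k X (n + 1) :=
  h.whisker.antisymmetrizer_smul

/-- To the left of the exchange of the first two factors, a coset sum may be replaced by an
antisymmetrizer, as `1 ⊗ 1 ⊗ A` can be inserted on the right and moved through the exchange. -/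
theorem whiskerEnd_cosetSum_mul_swapEnd {n : ℕ}
    (h : IsAlternating (R := End (tensorPow X (n + 1))) (AlgHom.id k _)
      (antisymmetrizer k X (n + 1))) :
    whiskerEnd k X (n + 1) (cosetSum k X (n + 1)) * swapEnd X (n + 2) 0 *
        whiskerEnd k X (n + 1) (antisymmetrizer k X (n + 1)) =
      (n + 1 : k) • (whiskerEnd k X (n + 1) (antisymmetrizer k X (n + 1)) * swapEnd X (n + 2) 0 *
        whiskerEnd k X (n + 1) (antisymmetrizer k X (n + 1))) := by
  have h₁ := whiskerEnd_antisymmetrizer_mul_of_isAlternating h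
  have h₂ := whiskerEnd_whiskerEnd_mul_swapEnd k X n (antisymmetrizer k X n)
  conv_lhs => rw [← h₁, map_mul, ← mul_assoc, mul_assoc _ (swapEnd _ _ _), ← h₂, ← mul_assoc,
    ← map_mul, ← smul_antisymmetrizer_succ, map_smul]
  rw [smul_mul_assoc, smul_mul_assoc]

/-- `Sₙ` acts on the image of the antisymmetrizer by the sign character. For `sᵢ` with `i > 0` this
follows from the case of `n - 1` after moving an antisymmetrizer to the left end of each term; for
`s₀` it follows from the braid relation. -/
theorem isAlternating_antisymmetrizer (n : ℕ) :
    IsAlternating (R := End (tensorPow X n)) (AlgHom.id k _) (antisymmetrizer k X n) := by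
  induction n with
  | zero => intro i hi; omega
  | succ n ih =>
    intro i hi
    obtain ⟨n, rfl⟩ : ∃ m, n = m + 1 := ⟨n - 1, by omega⟩
    set A := antisymmetrizer k X (n + 1) with hA
    suffices h : swapEnd X (n + 2) i * (cosetSum k X (n + 2) * whiskerEnd k X (n + 1) A) =
        -(cosetSum k X (n + 2) * whiskerEnd k X (n + 1) A) by
      rw [AlgHom.id_apply, smul_eq_mul, antisymmetrizer, mul_smul_comm, h, smul_neg]
    have hs : ∀ j, j + 1 < n + 1 → swapEnd X (n + 2) (j + 1) * whiskerEnd k X (n + 1) A =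
        -whiskerEnd k X (n + 1) A := by
      intro j hj
      rw [← whiskerEnd_swapEnd k, ← map_mul, ← map_neg]
      exact congrArg _ (ih j hj)
    rw [cosetSum]
    cases i with
    | zero =>
      cases n with
      | zero =>
        have h₁ := swapEnd_zero_mul_self X 0
        simp only [cosetSum, map_zero, zero_mul, sub_zero, map_one, one_mul]
        rw [← mul_assoc, mul_sub, h₁, mul_one, ← neg_mul, neg_sub]
      | succ n =>
        have h₁ := swapEnd_zero_mul_self X (n + 1)
        have h₂ := swapEnd_braid X n
        have h₃ := hs 0 (by omega)
        have h₄ := whiskerEnd_whiskerEnd_mul_swapEnd k X (n + 1) (cosetSum k X (n + 1))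
        rw [cosetSum, map_sub, map_mul, map_one, whiskerEnd_swapEnd]
        generalize whiskerEnd k X (n + 1 + 1) A = B at *
        generalize whiskerEnd k X (n + 1 + 1) (whiskerEnd k X (n + 1) (cosetSum k X (n + 1))) = L
          at *
        -- `s₀ L s₁ s₀ B = L s₁ s₀ s₁ B = -L s₁ s₀ B`, as `L` commutes with `s₀` and `s₁ B = -B`.
        have e : swapEnd X (n + 1 + 2) 0 * (L * swapEnd X (n + 1 + 1 + 1) (0 + 1) *
            swapEnd X (n + 1 + 2) 0 * B) =
            -(L * swapEnd X (n + 1 + 1 + 1) (0 + 1) * swapEnd X (n + 1 + 2) 0 * B) := by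
          calc
            _ = (swapEnd X (n + 1 + 2) 0 * L) * (swapEnd X (n + 1 + 1 + 1) (0 + 1) *
              swapEnd X (n + 1 + 2) 0 * B) := by simp only [mul_assoc]
            _ = L * ((swapEnd X (n + 3) 0 * swapEnd X (n + 3) 1 * swapEnd X (n + 3) 0) * B) := by
              rw [← h₄]; simp only [mul_assoc, zero_add]
            _ = L * (swapEnd X (n + 3) 1 * swapEnd X (n + 3) 0) * (swapEnd X (n + 3) 1 * B) := by
              rw [h₂]; simp only [mul_assoc]
            _ = _ := by
              erw [h₃]
              simp only [mul_assoc, mul_neg, zero_add]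
        simp only [sub_mul, one_mul, mul_sub]
        rw [← mul_assoc (swapEnd X (n + 1 + 2) 0) (swapEnd X (n + 1 + 2) 0) B, h₁, e]
        noncomm_ring
    | succ j =>
      obtain ⟨m, rfl⟩ : ∃ m, n = m + 1 := ⟨n - 1, by omega⟩
      have h₁ := whiskerEnd_cosetSum_mul_swapEnd ih
      rw [← hA] at h₁
      have h₂ : swapEnd X (m + 1 + 2) (j + 1) * (whiskerEnd k X (m + 1 + 1) A *
          swapEnd X (m + 1 + 2) 0 * whiskerEnd k X (m + 1 + 1) A) =
          -(whiskerEnd k X (m + 1 + 1) A *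
          swapEnd X (m + 1 + 2) 0 * whiskerEnd k X (m + 1 + 1) A) := by
        rw [← mul_assoc, ← mul_assoc, hs j (by omega), neg_mul, neg_mul]
      rw [sub_mul, one_mul, h₁, mul_sub, mul_smul_comm, h₂, hs j (by omega), smul_neg]
      abel

theorem antisymmetrizer_mul_self (n : ℕ) :
    antisymmetrizer k X n * antisymmetrizer k X n = antisymmetrizer k X n :=
  antisymmetrizer_mul_self_of_isAlternating (isAlternating_antisymmetrizer n)

/-- The recursion `(n + 1) Aₙ₊₁ = B - n B s₀ B` with `B = 1 ⊗ Aₙ`. -/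
theorem antisymmetrizer_recursion (n : ℕ) :
    (n + 2 : k) • antisymmetrizer k X (n + 2) =
      whiskerEnd k X (n + 1) (antisymmetrizer k X (n + 1)) -
      (n + 1 : k) • (whiskerEnd k X (n + 1) (antisymmetrizer k X (n + 1)) * swapEnd X (n + 2) 0 *
        whiskerEnd k X (n + 1) (antisymmetrizer k X (n + 1))) := by
  rw [← whiskerEnd_cosetSum_mul_swapEnd (isAlternating_antisymmetrizer (n + 1))]
  have h := smul_antisymmetrizer_succ (k := k) (X := X) (n + 1)
  rw [cosetSum, sub_mul, one_mul] at h
  rw [← h]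
  push_cast
  congr 1
  ring

theorem antisymmetrizer_one : antisymmetrizer k X 1 = 1 := by
  rw [antisymmetrizer, antisymmetrizer, cosetSum, cosetSum, map_zero, map_one]
  simp only [zero_mul, sub_zero, one_mul, Nat.cast_zero, zero_add, inv_one, one_smul]

end Antisymmetrizer

/-! ### Linearity and multiplicativity of the trace -/

section TraceLinear

variable (k : Type w) [Field k] {C : Type u} [Category.{v} C] [Abelian C] [Linear k C]
  [MonoidalCategory C] [SymmetricCategory C] [MonoidalPreadditive C] [MonoidalLinear k C]

/-- The partial trace as a linear map. -/
def ptrLinear {A B : C} (Y Y' : C) [ExactPairing Y Y'] : (A ⊗ Y ⟶ B ⊗ Y) →ₗ[k] (A ⟶ B) where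
  toFun := ptr Y Y'
  map_add' h h' := by simp [ptr, MonoidalPreadditive.add_whiskerRight]
  map_smul' a h := by simp [ptr]

theorem ptr_sub {A B : C} (Y Y' : C) [ExactPairing Y Y'] (h h' : A ⊗ Y ⟶ B ⊗ Y) :
    ptr Y Y' (h - h') = ptr Y Y' h - ptr Y Y' h' := by
  have e : (h - h') ▷ Y' = h ▷ Y' - h' ▷ Y' := (tensorRight Y').map_sub
  simp [ptr, e]

theorem ptr_smul {A B : C} (Y Y' : C) [ExactPairing Y Y'] (a : k) (h : A ⊗ Y ⟶ B ⊗ Y) :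
    ptr Y Y' (a • h) = a • ptr Y Y' h :=
  map_smul (ptrLinear k Y Y') a h

variable [RightRigidCategory C] [EndUnitIsScalar k C]

/-- The trace as a linear form on the endomorphism algebra of `X`. -/
def traceLinear (X : C) : End X →ₗ[k] k where
  toFun f := trace k (f : X ⟶ X)
  map_add' f h := by
    rw [trace, trace, trace, ← map_add]
    congr 1
    exact (by simp [loop, MonoidalPreadditive.add_whiskerRight] :
      ∀ f h : X ⟶ X, loop (f + h) = loop f + loop h) f h
  map_smul' a f := by
    rw [trace, trace, RingHom.id_apply, ← map_smul]
    congr 1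
    exact (by simp [loop] : ∀ f : X ⟶ X, loop (a • f) = a • loop f) f

theorem traceLinear_apply (X : C) (f : X ⟶ X) : traceLinear k X f = trace k f := rfl

theorem loop_eq_trace_smul {X : C} (f : X ⟶ X) : loop f = trace k f • 𝟙 (𝟙_ C) :=
  ((unitScalar k C).symm_apply_apply (loop f)).symm

theorem unitScalar_smul_id (a : k) : unitScalar k C (a • 𝟙 (𝟙_ C)) = a :=
  (unitScalar k C).apply_symm_apply a

theorem trace_comm {X Y : C} (f : X ⟶ Y) (h : Y ⟶ X) : trace k (f ≫ h) = trace k (h ≫ f) := by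
  rw [trace, trace, loop_comm]

theorem trace_ptr {X Y : C} (h : X ⊗ Y ⟶ X ⊗ Y) : trace k h = trace k (ptr Y (Yᘁ) h) := by
  rw [trace, trace, loop_tensor]

theorem ptr_whiskerLeft_eq_smul (X : C) {Y : C} (m : Y ⟶ Y) :
    ptr Y (Yᘁ) (X ◁ m) = trace k m • 𝟙 X := by
  rw [ptr_whiskerLeft_right, loop_eq_trace_smul k]
  simp

theorem trace_tensor {X Y : C} (f : X ⟶ X) (h : Y ⟶ Y) :
    trace k (f ⊗ₘ h) = trace k f * trace k h := by
  rw [trace_ptr, MonoidalCategory.tensorHom_def, ptr_comp_left, ptr_whiskerLeft_eq_smul k, Linear.comp_smul,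
    Category.comp_id, ← traceLinear_apply, mul_comm]
  exact map_smul (traceLinear k X) _ _

theorem trace_unit : trace k (𝟙 (𝟙_ C)) = 1 := by
  rw [trace, loop_unit]
  simpa using unitScalar_smul_id k (C := C) 1

end TraceLinear

/-! ### Newton's identities -/

section Newton

variable (k : Type w) [Field k] {C : Type u} [Category.{v} C] [Abelian C] [Linear k C]
  [MonoidalCategory C] [SymmetricCategory C] [MonoidalPreadditive C] [MonoidalLinear k C]
  [RightRigidCategory C] [EndUnitIsScalar k C]

/-- A family of endomorphisms which is a monoidal endomorphism of the identity functor. -/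
structure IsMonoidalEndo (γ : ∀ X : C, X ⟶ X) : Prop where
  naturality : ∀ {X Y : C} (f : X ⟶ Y), f ≫ γ Y = γ X ≫ f
  tensor : ∀ X Y : C, γ (X ⊗ Y) = γ X ⊗ₘ γ Y
  unit : γ (𝟙_ C) = 𝟙 _

variable {γ : ∀ X : C, X ⟶ X}

/-- The partial trace of `(B - c B s₀ B) γ` with `B = 1 ⊗ a` and `a` idempotent. Cyclicity merges the
two factors `B` of the second term, and `ptr_exch_comp` removes the exchange `s₀`. -/
theorem ptr_recursion (hγ : IsMonoidalEndo γ) (X T : C) (a : X ⊗ T ⟶ X ⊗ T) (haa : a ≫ a = a) (c : k) :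
    ptr (X ⊗ T) ((X ⊗ T)ᘁ) ((X ◁ a - c • (X ◁ a ≫ exch X T ≫ X ◁ a)) ≫ γ (X ⊗ (X ⊗ T))) =
      trace k (a ≫ γ (X ⊗ T)) • γ X - ptr T (Tᘁ) ((c • a) ≫ γ (X ⊗ T)) ≫ γ X := by
  have h₁ : γ (X ⊗ (X ⊗ T)) = X ◁ γ (X ⊗ T) ≫ γ X ▷ (X ⊗ T) := by rw [hγ.tensor, tensorHom_def']
  have h₂ : ptr (X ⊗ T) ((X ⊗ T)ᘁ) (X ◁ a ≫ γ (X ⊗ (X ⊗ T))) =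
      trace k (a ≫ γ (X ⊗ T)) • γ X := by
    rw [h₁, ← Category.assoc, ← MonoidalCategory.whiskerLeft_comp, ptr_comp_right,
      ptr_whiskerLeft_eq_smul k, Linear.smul_comp, Category.id_comp]
  have h₃ : ptr (X ⊗ T) ((X ⊗ T)ᘁ) ((X ◁ a ≫ exch X T ≫ X ◁ a) ≫ γ (X ⊗ (X ⊗ T))) =
      ptr T (Tᘁ) (a ≫ γ (X ⊗ T)) ≫ γ X := by
    have h₄ : ((exch X T ≫ X ◁ a) ≫ γ (X ⊗ (X ⊗ T))) ≫ X ◁ a =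
        (exch X T ≫ X ◁ (a ≫ γ (X ⊗ T))) ≫ γ X ▷ (X ⊗ T) := by
      rw [Category.assoc, ← hγ.naturality, Category.assoc, ← Category.assoc (X ◁ a),
        ← MonoidalCategory.whiskerLeft_comp, haa, h₁]
      simp
    rw [Category.assoc, ptr_cyclic (Z' := (X ⊗ T)ᘁ), h₄, ptr_comp_right,
      ptr_eq_of_pairing inferInstance (ExactPairing.tensor (Y₁ := (Xᘁ : C)) (Y₂ := (Tᘁ : C))),
      ptr_exch_comp]
  rw [Preadditive.sub_comp, ptr_sub, h₂, Linear.smul_comp _ _ _ c (X ◁ a ≫ exch X T ≫ X ◁ a),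
    ptr_smul, h₃, Linear.smul_comp, ptr_smul, Linear.smul_comp]

variable [CharZero k] (X : C) (γ)

/-- The trace of `γ` on the image of the antisymmetrizer on `X^{⊗n}`. -/
def elemTrace (n : ℕ) : k :=
  trace k ((antisymmetrizer k X n : tensorPow X n ⟶ tensorPow X n) ≫ γ (tensorPow X n))

/-- The partial trace over all factors but the first of `n + 1` times the antisymmetrizer on
`X^{⊗(n + 1)}`, composed with `γ`. -/
def hookTrace (n : ℕ) : X ⟶ X :=
  ptr (tensorPow X n) ((tensorPow X n)ᘁ)
    (((n + 1 : k) • (antisymmetrizer k X (n + 1) : X ⊗ tensorPow X n ⟶ X ⊗ tensorPow X n)) ≫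
      γ (X ⊗ tensorPow X n))

theorem trace_hookTrace (n : ℕ) :
    trace k (hookTrace k γ X n) = (n + 1) * elemTrace k γ X (n + 1) := by
  rw [hookTrace, ← trace_ptr]
  refine (congrArg (trace k) (Linear.smul_comp _ _ _ (n + 1 : k) _ _)).trans ?_
  exact map_smul (traceLinear k _) _ _

variable {γ}

theorem hookTrace_zero (hγ : IsMonoidalEndo γ) : hookTrace k γ X 0 = elemTrace k γ X 0 • γ X := by
  have h₁ : (((0 : ℕ) : k) + 1) • (antisymmetrizer k X 1 : X ⊗ tensorPow X 0 ⟶ X ⊗ tensorPow X 0) =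
      𝟙 (X ⊗ tensorPow X 0) := by
    rw [Nat.cast_zero, zero_add, one_smul]
    exact antisymmetrizer_one
  have h₂ : (antisymmetrizer k X 0 : tensorPow X 0 ⟶ tensorPow X 0) = 𝟙 _ := rfl
  refine (congrArg (fun m : X ⊗ tensorPow X 0 ⟶ X ⊗ tensorPow X 0 =>
    ptr (tensorPow X 0) ((tensorPow X 0)ᘁ) (m ≫ γ (X ⊗ tensorPow X 0))) h₁).trans ?_
  rw [elemTrace, h₂, hγ.tensor, MonoidalCategory.tensorHom_def, Category.id_comp, Category.id_comp,
    ptr_comp_left, ptr_whiskerLeft_eq_smul k, Linear.comp_smul, Category.comp_id]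

theorem hookTrace_succ (hγ : IsMonoidalEndo γ) (n : ℕ) :
    hookTrace k γ X (n + 1) = elemTrace k γ X (n + 1) • γ X - hookTrace k γ X n ≫ γ X := by
  have h₁ : (n + 2 : k) • (antisymmetrizer k X (n + 2) :
      X ⊗ X ⊗ tensorPow X n ⟶ X ⊗ X ⊗ tensorPow X n) = _ := antisymmetrizer_recursion n
  have h₂ : (antisymmetrizer k X (n + 1) : X ⊗ tensorPow X n ⟶ X ⊗ tensorPow X n) ≫
      (antisymmetrizer k X (n + 1) : X ⊗ tensorPow X n ⟶ X ⊗ tensorPow X n) =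
      antisymmetrizer k X (n + 1) := antisymmetrizer_mul_self (n + 1)
  have h₃ := ptr_recursion k hγ X (tensorPow X n) _ h₂ (n + 1)
  refine Eq.trans ?_ h₃
  have h₄ : ((n + 1 : ℕ) : k) + 1 = n + 2 := by push_cast; ring
  rw [hookTrace, h₄]
  refine congrArg (fun m : X ⊗ X ⊗ tensorPow X n ⟶ X ⊗ X ⊗ tensorPow X n =>
    ptr (X ⊗ tensorPow X n) ((X ⊗ tensorPow X n)ᘁ) (m ≫ γ (X ⊗ X ⊗ tensorPow X n)))
    (h₁.trans ?_)
  congr 2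

theorem hookTrace_eq_sum (hγ : IsMonoidalEndo γ) (n : ℕ) :
    End.of (hookTrace k γ X n) = ∑ p ∈ Finset.HasAntidiagonal.antidiagonal n,
      (elemTrace k γ X p.1 * (-1) ^ p.2) • End.of (γ X) ^ (p.2 + 1) := by
  induction n with
  | zero => simpa using hookTrace_zero k X hγ
  | succ n ih =>
    have h : End.of (hookTrace k γ X (n + 1)) =
      elemTrace k γ X (n + 1) • End.of (γ X) - End.of (γ X) * End.of (hookTrace k γ X n) :=
      hookTrace_succ k X hγ n
    rw [h, ih, Finset.Nat.sum_antidiagonal_succ', Finset.mul_sum]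
    simp only [pow_zero, mul_one, zero_add, pow_one]
    rw [sub_eq_add_neg, ← Finset.sum_neg_distrib]
    congr 1
    refine Finset.sum_congr rfl fun p _ => ?_
    rw [mul_smul_comm, ← pow_succ', pow_succ (-1 : k), ← neg_smul]
    congr 1
    ring

/-- Newton's identities between the traces on exterior powers and the traces of powers. -/
theorem newton_identity (hγ : IsMonoidalEndo γ) (n : ℕ) :
    (n + 1) * elemTrace k γ X (n + 1) = ∑ p ∈ Finset.HasAntidiagonal.antidiagonal n,
      elemTrace k γ X p.1 * ((-1) ^ p.2 * traceLinear k X (End.of (γ X) ^ (p.2 + 1))) := by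
  rw [← trace_hookTrace, ← traceLinear_apply]
  refine (congrArg (traceLinear k X) (hookTrace_eq_sum k X hγ n)).trans ?_
  rw [map_sum]
  exact Finset.sum_congr rfl fun p _ => by rw [map_smul, smul_eq_mul, mul_assoc]

/-- The exterior power is the image of the antisymmetrizer, so that the trace of `γ` on it is
computed on the tensor power. -/
theorem trace_exteriorPower (hγ : IsMonoidalEndo γ) (n : ℕ) :
    trace k (γ (exteriorPower X n)) = elemTrace k γ X n := by
  let t : tensorPow X n ⟶ _ :=
    Pi.lift fun i : Fin (n - 1) => 𝟙 (tensorPow X n) + adjSwap X n i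
  let a : tensorPow X n ⟶ tensorPow X n := antisymmetrizer k X n
  have h₁ : a ≫ t = 0 := by
    refine Pi.hom_ext _ _ fun i => ?_
    have h : a ≫ adjSwap X n i = -a := isAlternating_antisymmetrizer n i (by omega)
    simp [t, h]
  have h₂ : kernel.ι t ≫ a = kernel.ι t := by
    refine IsAlternating.antisymmetrizer_smul (R := End (tensorPow X n)) (ω := AlgHom.id k _)
      (m := kernel.ι t) fun i hi => ?_
    have h : kernel.ι t ≫ (𝟙 _ + adjSwap X n i) = 0 := by
      have := kernel.condition t =≫ Pi.π _ (⟨i, by omega⟩ : Fin (n - 1))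
      rw [Category.assoc, Pi.lift_π, zero_comp] at this
      exact this
    rw [Preadditive.comp_add, Category.comp_id, add_comm] at h
    exact eq_neg_of_add_eq_zero_left h
  -- The antisymmetrizer splits through the exterior power as a retraction followed by the inclusion.
  let r : tensorPow X n ⟶ kernel t := kernel.lift t a h₁
  have hr : r ≫ kernel.ι t = a := kernel.lift_ι _ _ _
  have hr' : kernel.ι t ≫ r = 𝟙 _ := by
    rw [← cancel_mono (kernel.ι t), Category.assoc, hr, h₂, Category.id_comp]
  change trace k (γ (kernel t)) = trace k (a ≫ γ _)
  calc
    _ = trace k (kernel.ι t ≫ r ≫ γ (kernel t)) := by rw [reassoc_of% hr']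
    _ = _ := by rw [trace_comm, Category.assoc, ← hγ.naturality, reassoc_of% hr]

end Newton

/-! ### The trace as a ring homomorphism on the Grothendieck ring -/

section GrothendieckRing

variable {C : Type u} [Category.{v} C] [Abelian C] [MonoidalCategory C] [SymmetricCategory C]
  [RightRigidCategory C] [MonoidalPreadditive C]

theorem K0.induction {p : K0 C → Prop} (x : K0 C) (cls : ∀ X, p (K0.cls X))
    (neg : ∀ x, p x → p (-x)) (add : ∀ x y, p x → p y → p (x + y)) : p x := by
  obtain ⟨v, rfl⟩ := K0.ofVirtual_surjective x
  have of : ∀ X : C, p (K0.ofVirtual (FreeAbelianGroup.of X)) := fun X => by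
    simpa [K0.ofVirtual] using cls X
  induction v using FreeAbelianGroup.induction_on with
  | zero => simpa using add _ _ (cls (𝟙_ C)) (neg _ (cls (𝟙_ C)))
  | of X => exact of X
  | neg X h => rw [map_neg]; exact neg _ h
  | add a b h₁ h₂ => rw [map_add]; exact add _ _ h₁ h₂

theorem K0.cls_mul (X Y : C) : K0.cls X * K0.cls Y = K0.cls (X ⊗ Y) := by
  unfold K0.cls
  rw [← map_mul, isoClass_mul]

theorem K0.cls_unit : K0.cls (𝟙_ C) = 1 := rfl

variable (k : Type w) [Field k] [Linear k C] [MonoidalLinear k C] [EndUnitIsScalar k C]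

/-- The trace of a monoidal endomorphism of the identity functor is a ring homomorphism on the
Grothendieck ring. -/
def K0.traceHom (g : 𝟭 C ⟶ 𝟭 C) (hg : IsMonoidalEndo (C := C) fun X => g.app X) : K0 C →+* k :=
  { K0.trace k g with
    map_one' := by
      change K0.trace k g 1 = 1
      rw [← K0.cls_unit, K0.trace_cls, ← trace_unit k (C := C)]
      exact congrArg (TensorCat.trace k) hg.unit
    map_mul' := fun x y => by
      change K0.trace k g (x * y) = K0.trace k g x * K0.trace k g y
      refine K0.induction
        (p := fun x => K0.trace k g (x * y) = K0.trace k g x * K0.trace k g y) x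
        (fun X => K0.induction (p := fun y => K0.trace k g (K0.cls X * y) =
          K0.trace k g (K0.cls X) * K0.trace k g y) y (fun Y => ?_) ?_ ?_) ?_ ?_
      · rw [K0.cls_mul, K0.trace_cls, K0.trace_cls, K0.trace_cls]
        exact (congrArg (TensorCat.trace k) (hg.tensor X Y)).trans (trace_tensor k _ _)
      · intro y h; rw [mul_neg, map_neg, map_neg, h, mul_neg]
      · intro y z h₁ h₂; rw [mul_add, map_add, map_add, h₁, h₂, mul_add]
      · intro x h; rw [neg_mul, map_neg, map_neg, h, neg_mul]
      · intro x z h₁ h₂; rw [add_mul, map_add, map_add, h₁, h₂, add_mul] }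

theorem K0.traceHom_apply (g : 𝟭 C ⟶ 𝟭 C) (hg : IsMonoidalEndo (C := C) fun X => g.app X)
    (x : K0 C) : K0.traceHom k g hg x = K0.trace k g x := rfl

end GrothendieckRing

/-! ### Adams operations -/

section Adams

variable {C : Type u} [Category.{v} C] [Abelian C] [MonoidalCategory C] [SymmetricCategory C]
  [RightRigidCategory C] [MonoidalPreadditive C]

open PowerSeries

theorem adamsSeries_add (x y : FreeAbelianGroup C) :
    adamsSeries (x + y) = adamsSeries x + adamsSeries y := by
  unfold adamsSeries
  rw [← map_add, map_add, toMul_add]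
  generalize (lambdaSeries x).toMul = a
  generalize (lambdaSeries y).toMul = b
  congr 1
  rw [mul_inv, Units.val_mul, Units.val_mul, Derivation.leibniz, smul_eq_mul, smul_eq_mul]
  linear_combination (-X * d⁄dX (K0 C) (b : (K0 C)⟦X⟧) * ((b⁻¹ : ((K0 C)⟦X⟧)ˣ) : (K0 C)⟦X⟧)) *
    a.mul_inv + (-X * d⁄dX (K0 C) (a : (K0 C)⟦X⟧) * ((a⁻¹ : ((K0 C)⟦X⟧)ˣ) : (K0 C)⟦X⟧)) * b.mul_inv

/-- The Adams operation as a homomorphism on virtual objects. -/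
def adamsHom (n : ℕ) : FreeAbelianGroup C →+ K0 C :=
  AddMonoidHom.mk' (adams n) fun x y => by
    rw [adams, adams, adams, adamsSeries_add, map_add]

/-- Up to sign, the Adams operations of an object are the coefficients of the logarithmic derivative
of its exterior series. -/
theorem adams_succ_of (n : ℕ) (X : C) :
    adams (n + 1) (FreeAbelianGroup.of X) =
      (-1) ^ n * coeff n (d⁄dX (K0 C) (exteriorSeries X) *
        (((isUnit_exteriorSeries X).unit⁻¹ : ((K0 C)⟦X⟧)ˣ) : (K0 C)⟦X⟧)) := by
  have h : lambdaSeries (FreeAbelianGroup.of X) =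
      Additive.ofMul (isUnit_exteriorSeries X).unit := by simp [lambdaSeries]
  rw [adams, adamsSeries, h, evalNegHom, coeff_rescale, mul_assoc, neg_mul, map_neg,
    coeff_succ_X_mul, toMul_ofMul, IsUnit.unit_spec, pow_succ]
  ring

theorem map_derivative {R S : Type*} [CommRing R] [CommRing S] (φ : R →+* S) (f : R⟦X⟧) :
    PowerSeries.map φ (d⁄dX R f) = d⁄dX S (PowerSeries.map φ f) := by
  ext n
  simp [coeff_derivative]

variable (k : Type w) [Field k] [CharZero k] [Linear k C] [MonoidalLinear k C]
  [EndUnitIsScalar k C]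

/-- The case of an object: with `E = ∑ eⱼ tʲ` and `S = ∑ (-1)^j pⱼ₊₁ tʲ`, Newton's identities say
`E' = E S`, so that `S` is the logarithmic derivative of `E`. -/
theorem trace_adams_of (g : 𝟭 C ⟶ 𝟭 C) (hg : IsMonoidalEndo (C := C) fun X => g.app X) (n : ℕ)
    (X : C) : K0.trace k g (adams (n + 1) (FreeAbelianGroup.of X)) =
      traceLinear k X (End.of (g.app X : X ⟶ X) ^ (n + 1)) := by
  let χ := K0.traceHom k g hg
  let E : k⟦X⟧ := PowerSeries.mk (elemTrace k (fun X : C => g.app X) X)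
  let S : k⟦X⟧ := PowerSeries.mk fun j =>
    (-1) ^ j * traceLinear k X (End.of (g.app X : X ⟶ X) ^ (j + 1))
  have hE : PowerSeries.map χ (exteriorSeries X) = E := by
    ext j
    rw [coeff_map, exteriorSeries, coeff_mk, coeff_mk, K0.traceHom_apply, K0.trace_cls]
    exact trace_exteriorPower k X hg j
  have hS : d⁄dX k E = E * S := by
    ext j
    rw [coeff_derivative, coeff_mul, coeff_mk, mul_comm, newton_identity k X hg]
    simp only [E, S, coeff_mk]
  set u := (isUnit_exteriorSeries X).unit
  have hu : PowerSeries.map χ (d⁄dX (K0 C) (exteriorSeries X) *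
      ((u⁻¹ : ((K0 C)⟦X⟧)ˣ) : (K0 C)⟦X⟧)) = S := by
    have h₁ : E * PowerSeries.map χ ((u⁻¹ : ((K0 C)⟦X⟧)ˣ) : (K0 C)⟦X⟧) = 1 := by
      rw [← hE, ← map_mul, ← (isUnit_exteriorSeries X).unit_spec, Units.mul_inv, map_one]
    rw [map_mul, map_derivative, hE, hS, mul_right_comm, h₁, one_mul]
  rw [adams_succ_of, ← K0.traceHom_apply k g hg, map_mul, map_pow, map_neg, map_one,
    ← coeff_map, hu, coeff_mk, ← mul_assoc, ← mul_pow]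
  simp

/-- A monoidal automorphism is the identity on the unit object, being an invertible idempotent
there. -/
theorem isMonoidalEndo_of_aut (g : Aut (𝟭 C))
    (hg : ∀ X Y : C, g.hom.app (X ⊗ Y) = g.hom.app X ⊗ₘ g.hom.app Y) :
    IsMonoidalEndo (C := C) fun X => g.hom.app X where
  naturality f := g.hom.naturality f
  tensor := hg
  unit := by
    let t : 𝟙_ C ⟶ 𝟙_ C := g.hom.app (𝟙_ C)
    have ht : IsIso t := (Iso.app g (𝟙_ C)).isIso_hom
    have h₁ : (λ_ (𝟙_ C)).hom ≫ t = (t ⊗ₘ t) ≫ (λ_ (𝟙_ C)).hom := by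
      have := g.hom.naturality (λ_ (𝟙_ C)).hom
      rw [hg] at this
      exact this
    have h₂ : (t ⊗ₘ t) ≫ (λ_ (𝟙_ C)).hom = (λ_ (𝟙_ C)).hom ≫ t ≫ t := by
      rw [MonoidalCategory.tensorHom_def, Category.assoc, leftUnitor_naturality, unitors_equal,
        rightUnitor_naturality_assoc]
    rw [h₂, cancel_epi] at h₁
    change t = 𝟙 _
    rw [← cancel_epi t, ← h₁, Category.comp_id]

theorem app_pow (g : Aut (𝟭 C)) (X : C) (n : ℕ) :
    End.of ((g ^ n).hom.app X : X ⟶ X) = End.of (g.hom.app X : X ⟶ X) ^ n := by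
  induction n with
  | zero => rfl
  | succ n ih =>
    rw [pow_succ (End.of _), ← ih, pow_succ]
    rfl

end Adams
end TensorCat
end

theorem mainTheorem5 {k : Type*} [Field k] [IsAlgClosed k] [CharZero k]
    {C : Type*} [Category* C] [Abelian C] [Linear k C]
    [MonoidalCategory C] [SymmetricCategory C] [RightRigidCategory C]
    [MonoidalPreadditive C] [MonoidalLinear k C] [TensorCat.EndUnitIsScalar k C]
    (g : Aut (𝟭 C))
    (hg : ∀ X Y : C, g.hom.app (X ⊗ Y) = g.hom.app X ⊗ₘ g.hom.app Y)
    (n : ℕ) (hn : 1 ≤ n) (x : TensorCat.K0 C)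
    (v : FreeAbelianGroup C) (hv : TensorCat.K0.ofVirtual v = x) :
    TensorCat.K0.trace k g.hom (TensorCat.adams n v) = TensorCat.K0.trace k (g ^ n).hom x := by
  subst hv
  obtain ⟨n, rfl⟩ : ∃ m, n = m + 1 := ⟨n - 1, by omega⟩
  have h : (TensorCat.K0.trace k g.hom).comp (TensorCat.adamsHom (n + 1)) =
      (TensorCat.K0.trace k (g ^ (n + 1)).hom).comp TensorCat.K0.ofVirtual := by
    refine FreeAbelianGroup.lift_ext _ _ fun X => ?_
    have hX : TensorCat.K0.ofVirtual (FreeAbelianGroup.of X) = TensorCat.K0.cls X := by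
      simp [TensorCat.K0.ofVirtual]
    refine (TensorCat.trace_adams_of k g.hom (TensorCat.isMonoidalEndo_of_aut g hg) n X).trans ?_
    rw [AddMonoidHom.comp_apply, hX, TensorCat.K0.trace_cls, ← TensorCat.app_pow]
    rfl
  exact DFunLike.congr_fun h v
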